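/- Let $G=(V,E)$ be a finite simple graph without isolated vertices. A bijection $f:E\to\{1,2,\dots,|E|\}$ is called a \emph{local antimagic labeling} of $G$ if $w(u)\neq w(v)$ for every edge $uv\in E$, where the weight $w(u)$ of a vertex $u$ is the sum of the labels $f(e)$ over all edges $e$ incident to $u$. The \emph{local antimagic chromatic number} $\chi_{la}(G)$ is the minimum, over all local antimagic labelings $f$ of $G$, of the number of distinct vertex weights. For $r\ge 1$ let $rK_{m,m}$ denote the disjoint union of $r$ copies of the complete bipartite graph $K_{m,m}$. **Theorem.** Let $m\geq 4$ be even and let $r\geq 1$. Then $\chi_{la}(rK_{m,m})=3$. -/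

import Mathlib

namespace LocalAntimagic

variable {V : Type*}

/-- The weight `w(u)` of a vertex `u` under an edge labeling `f`: the sum of the labels of the
edges of `G` incident to `u`. (Values of `f` at pairs that are not edges of `G` are irrelevant.) -/
def weight (G : SimpleGraph V) [Fintype V] [DecidableEq V] [DecidableRel G.Adj]
    (f : Sym2 V → ℕ) (u : V) : ℕ :=
  ∑ e ∈ G.incidenceFinset u, f e

/-- `f` restricts to a bijection from the edges of `G` to `{1, …, |E(G)|}`, and adjacent vertices
have distinct weights. -/
structure IsLocalAntimagicLabeling (G : SimpleGraph V) [Fintype V] [DecidableEq V]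
    [DecidableRel G.Adj] (f : Sym2 V → ℕ) : Prop where
  bijOn : Set.BijOn f G.edgeSet (Set.Icc 1 G.edgeFinset.card)
  weight_ne : ∀ ⦃u v : V⦄, G.Adj u v → weight G f u ≠ weight G f v

/-- The number of colors (distinct vertex weights) in the coloring induced by `f`. -/
def numColors (G : SimpleGraph V) [Fintype V] [DecidableEq V] [DecidableRel G.Adj]
    (f : Sym2 V → ℕ) : ℕ :=
  (Finset.univ.image (weight G f)).card

/-- The local antimagic chromatic number: the minimum number of colors over all local antimagic
labelings of `G`, with value `⊤` if there is no such labeling. -/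
noncomputable def chiLa (G : SimpleGraph V) [Fintype V] [DecidableEq V] [DecidableRel G.Adj] :
    ℕ∞ :=
  sInf {k : ℕ∞ | ∃ f : Sym2 V → ℕ, IsLocalAntimagicLabeling G f ∧ k = (numColors G f : ℕ∞)}

/-- The disjoint union `rG` of `r` copies of `G`. -/
def copies (r : ℕ) (G : SimpleGraph V) : SimpleGraph (Fin r × V) where
  Adj p q := p.1 = q.1 ∧ G.Adj p.2 q.2
  symm := ⟨fun _ _ h => ⟨h.1.symm, h.2.symm⟩⟩
  loopless := ⟨fun _ h => G.loopless.irrefl _ h.2⟩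

instance (r : ℕ) (G : SimpleGraph V) [DecidableRel G.Adj] : DecidableRel (copies r G).Adj :=
  fun p q => inferInstanceAs (Decidable (p.1 = q.1 ∧ G.Adj p.2 q.2))

instance (V W : Type*) : DecidableRel (completeBipartiteGraph V W).Adj :=
  fun v w => inferInstanceAs
    (Decidable ((v.isLeft = true ∧ w.isRight = true) ∨ (v.isRight = true ∧ w.isLeft = true)))

end LocalAntimagic

/-! A labeling of `rK_{m,m}` is a family of `r` square arrays, with row and column sums as weights.
Summing one array both ways excludes two colors (`three_le_numColors`). For three colors, put `m =
2h` and `N = 2rh²`, and split the labels into complementary pairs `{N + 1 + k, N - k}` with `0 ≤ k <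
N`. Each pair fills two horizontally adjacent cells, the larger label going where `i + j` is even,
and `k` grows by one from each row to the next. Then every row sums to `h(2N + 1)`, while a column
sums to `2hN` or `h(2N + 2)` according to its parity (`sum_row_entry`, `sum_col_entry`). -/

namespace LocalAntimagic

section Copies

variable {m r : ℕ}

/-- The edge of `rK_{m,m}` in copy `x.1` joining row vertex `x.2.1` and column vertex `x.2.2`. -/
def biEdge (x : Fin r × Fin m × Fin m) : Sym2 (Fin r × (Fin m ⊕ Fin m)) :=
  s((x.1, Sum.inl x.2.1), (x.1, Sum.inr x.2.2))

lemma biEdge_injective : Function.Injective (biEdge : Fin r × Fin m × Fin m → _) := by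
  rintro ⟨c, i, j⟩ ⟨c', i', j'⟩ h
  simp only [biEdge, Sym2.eq_iff, Prod.mk.injEq, Sum.inl.injEq, Sum.inr.injEq, reduceCtorEq,
    and_false, or_false] at h
  obtain ⟨⟨rfl, rfl⟩, -, rfl⟩ := h
  rfl

lemma range_biEdge :
    Set.range (biEdge : Fin r × Fin m × Fin m → _) =
      (copies r (completeBipartiteGraph (Fin m) (Fin m))).edgeSet := by
  ext e
  induction e with | _ p q
  obtain ⟨c, a⟩ := p
  obtain ⟨d, b⟩ := q
  rw [SimpleGraph.mem_edgeSet]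
  constructor
  · rintro ⟨⟨c', i, j⟩, h⟩
    rcases Sym2.eq_iff.1 h with ⟨h1, h2⟩ | ⟨h1, h2⟩ <;>
    · cases h1
      cases h2
      simp [copies]
  · rintro ⟨h, h'⟩
    obtain rfl : c = d := h
    rcases a with i | i <;> rcases b with j | j <;> simp at h'
    · exact ⟨(c, i, j), rfl⟩
    · exact ⟨(c, j, i), Sym2.eq_swap⟩

lemma card_edgeFinset_copies :
    (copies r (completeBipartiteGraph (Fin m) (Fin m))).edgeFinset.card = r * (m * m) := by
  rw [← Set.ncard_coe_finset, SimpleGraph.coe_edgeFinset, ← range_biEdge, ← Set.image_univ,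
    Set.ncard_image_of_injective _ biEdge_injective, Set.ncard_univ]
  simp

lemma biEdge_mem_edgeSet (x : Fin r × Fin m × Fin m) :
    biEdge x ∈ (copies r (completeBipartiteGraph (Fin m) (Fin m))).edgeSet :=
  range_biEdge ▸ Set.mem_range_self x

lemma weight_inl (f : Sym2 (Fin r × (Fin m ⊕ Fin m)) → ℕ) (c : Fin r) (i : Fin m) :
    weight (copies r (completeBipartiteGraph (Fin m) (Fin m))) f (c, Sum.inl i) =
      ∑ j, f (biEdge (c, i, j)) := by
  symm
  refine Finset.sum_nbij (fun j => biEdge (c, i, j)) ?_ ?_ ?_ fun _ _ => rfl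
  · intro j _
    rw [SimpleGraph.mem_incidenceFinset]
    exact ⟨biEdge_mem_edgeSet _, by simp [biEdge]⟩
  · intro j _ j' _ h
    simpa using biEdge_injective h
  · intro e he
    rw [Finset.mem_coe, SimpleGraph.mem_incidenceFinset] at he
    obtain ⟨he, hc⟩ := he
    rw [← range_biEdge] at he
    obtain ⟨⟨c', i', j⟩, rfl⟩ := he
    simp only [biEdge, Sym2.mem_iff, Prod.mk.injEq, Sum.inl.injEq, reduceCtorEq, and_false,
      or_false] at hc
    obtain ⟨rfl, rfl⟩ := hc
    exact ⟨j, by simp, rfl⟩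

lemma weight_inr (f : Sym2 (Fin r × (Fin m ⊕ Fin m)) → ℕ) (c : Fin r) (j : Fin m) :
    weight (copies r (completeBipartiteGraph (Fin m) (Fin m))) f (c, Sum.inr j) =
      ∑ i, f (biEdge (c, i, j)) := by
  symm
  refine Finset.sum_nbij (fun i => biEdge (c, i, j)) ?_ ?_ ?_ fun _ _ => rfl
  · intro i _
    rw [SimpleGraph.mem_incidenceFinset]
    exact ⟨biEdge_mem_edgeSet _, by simp [biEdge]⟩
  · intro i _ i' _ h
    simpa using biEdge_injective h
  · intro e he
    rw [Finset.mem_coe, SimpleGraph.mem_incidenceFinset] at he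
    obtain ⟨he, hc⟩ := he
    rw [← range_biEdge] at he
    obtain ⟨⟨c', i, j'⟩, rfl⟩ := he
    simp only [biEdge, Sym2.mem_iff, Prod.mk.injEq, Sum.inr.injEq, reduceCtorEq, and_false,
      false_or] at hc
    obtain ⟨rfl, rfl⟩ := hc
    exact ⟨i, by simp, rfl⟩

/-- Two colors never suffice: otherwise all rows of a copy would have one weight and all columns
another, although the rows and the columns of a copy have the same total weight. -/
lemma three_le_numColors (hm : 0 < m) (hr : 0 < r) {f : Sym2 (Fin r × (Fin m ⊕ Fin m)) → ℕ}
    (hf : IsLocalAntimagicLabeling (copies r (completeBipartiteGraph (Fin m) (Fin m))) f) :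
    3 ≤ numColors (copies r (completeBipartiteGraph (Fin m) (Fin m))) f := by
  set G := copies r (completeBipartiteGraph (Fin m) (Fin m)) with hG
  let c : Fin r := ⟨0, hr⟩
  let z : Fin m := ⟨0, hm⟩
  have hne : ∀ i j, weight G f (c, Sum.inl i) ≠ weight G f (c, Sum.inr j) := fun i j =>
    hf.weight_ne (biEdge_mem_edgeSet (c, i, j))
  by_contra! hlt
  have hthree : ∀ u v w, weight G f u ≠ weight G f v → weight G f w ≠ weight G f v →
      weight G f w = weight G f u := by
    intro u v w huv hwv
    by_contra hwu
    have hsub : ({weight G f u, weight G f v, weight G f w} : Finset ℕ) ⊆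
        Finset.univ.image (weight G f) := by
      intro x hx
      simp only [Finset.mem_insert, Finset.mem_singleton] at hx
      rcases hx with rfl | rfl | rfl <;> exact Finset.mem_image_of_mem _ (Finset.mem_univ _)
    have hcard := Finset.card_le_card hsub
    rw [Finset.card_eq_three.2 ⟨_, _, _, huv, Ne.symm hwu, Ne.symm hwv, rfl⟩] at hcard
    exact absurd hlt (not_lt.2 hcard)
  have hrow : ∀ i, weight G f (c, Sum.inl i) = weight G f (c, Sum.inl z) := fun i =>
    hthree _ (c, Sum.inr z) _ (hne z z) (hne i z)
  have hcol : ∀ j, weight G f (c, Sum.inr j) = weight G f (c, Sum.inr z) := fun j =>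
    hthree _ (c, Sum.inl z) _ (hne z z).symm (hne z j).symm
  have htotal : ∑ i, weight G f (c, Sum.inl i) = ∑ j, weight G f (c, Sum.inr j) := by
    simp only [hG, weight_inl, weight_inr]
    exact Finset.sum_comm
  simp only [hrow, hcol, Finset.sum_const, Finset.card_univ, Fintype.card_fin, smul_eq_mul]
    at htotal
  exact hne z z (Nat.eq_of_mul_eq_mul_left hm htotal)

/-- The edge labeling of `rK_{m,m}` given by an array for each copy. -/
def arrayLabeling (F : Fin r × Fin m × Fin m → ℕ) : Sym2 (Fin r × (Fin m ⊕ Fin m)) → ℕ :=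
  Sym2.lift ⟨fun p q =>
    match p, q with
    | (c, Sum.inl i), (_, Sum.inr j) => F (c, i, j)
    | (_, Sum.inr j), (c, Sum.inl i) => F (c, i, j)
    | _, _ => 0, by
    rintro ⟨c, i | i⟩ ⟨d, j | j⟩ <;> rfl⟩

lemma bijOn_arrayLabeling {F : Fin r × Fin m × Fin m → ℕ} (hF : Function.Injective F)
    (hmem : ∀ x, F x ∈ Set.Icc 1 (r * (m * m))) :
    Set.BijOn (arrayLabeling F) (copies r (completeBipartiteGraph (Fin m) (Fin m))).edgeSet
      (Set.Icc 1 (copies r (completeBipartiteGraph (Fin m) (Fin m))).edgeFinset.card) := by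
  rw [card_edgeFinset_copies, ← range_biEdge]
  refine ⟨?_, ?_, ?_⟩
  · rintro _ ⟨x, rfl⟩
    exact hmem x
  · rintro _ ⟨x, rfl⟩ _ ⟨y, rfl⟩ h
    exact congrArg _ (hF h)
  -- Surjectivity follows from injectivity, since both sides have `r * (m * m)` elements.
  · intro n hn
    obtain ⟨x, -, hx⟩ := Finset.surj_on_of_inj_on_of_card_le (s := Finset.univ)
      (t := Finset.Icc 1 (r * (m * m))) (fun x _ => F x) (fun x _ => Finset.mem_Icc.2 (hmem x))
      (fun x y _ _ h => hF h) (by simp) n (Finset.mem_Icc.2 hn)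
    exact ⟨biEdge x, ⟨x, rfl⟩, hx.symm⟩

end Copies

section Construction

variable {r h : ℕ}

/-- The rank of the complementary pair of labels containing the entry `(i, j)` of copy `c`. -/
def pairRank (h c i j : ℕ) : ℕ := (c * h + j / 2) * (2 * h) + i

/-- The entry `(i, j)` of copy `c`: one of the two labels `2rh² + 1 + k` and `2rh² - k`, where `k`
is the rank of the pair, chosen by the parity of `i + j`. -/
def entry (r h c i j : ℕ) : ℕ :=
  if (i + j) % 2 = 0 then 2 * r * h * h + 1 + pairRank h c i j
  else 2 * r * h * h - pairRank h c i j

lemma pairRank_lt {c i j : ℕ} (hc : c < r) (hi : i < 2 * h) (hj : j < 2 * h) :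
    pairRank h c i j < 2 * r * h * h := by
  have h1 : c * h + j / 2 + 1 ≤ r * h := by
    have := Nat.mul_le_mul_right h (Nat.succ_le_of_lt hc)
    rw [Nat.succ_mul] at this
    omega
  have h2 := Nat.mul_le_mul_right (2 * h) h1
  rw [Nat.succ_mul] at h2
  have h3 : r * h * (2 * h) = 2 * r * h * h := by ring
  unfold pairRank
  omega

lemma eq_of_mul_add_eq {n a b a' b' : ℕ} (hb : b < n) (hb' : b' < n)
    (he : a * n + b = a' * n + b') : a = a' ∧ b = b' := by
  have hn : 0 < n := by omega
  have h1 := congrArg (· / n) he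
  have h2 := congrArg (· % n) he
  simp only [Nat.mul_add_mod', Nat.mod_eq_of_lt hb, Nat.mod_eq_of_lt hb'] at h2
  subst h2
  exact ⟨Nat.eq_of_mul_eq_mul_right hn (by omega), rfl⟩

/-- Whether a label exceeds `2rh²` reveals the parity of `i + j`, and then its rank. The mixed-radix
digits of the rank are `c`, `j / 2` and `i`; the parity then fixes `j`. -/
lemma entry_injective :
    Function.Injective fun x : Fin r × Fin (2 * h) × Fin (2 * h) =>
      entry r h x.1 x.2.1 x.2.2 := by
  rintro ⟨c, i, j⟩ ⟨c', i', j'⟩ he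
  have hk := pairRank_lt c.2 i.2 j.2
  have hk' := pairRank_lt c'.2 i'.2 j'.2
  simp only [entry] at he
  have hpar : ((i : ℕ) + j) % 2 = ((i' : ℕ) + j') % 2 := by split_ifs at he <;> omega
  have hrank : pairRank h c i j = pairRank h c' i' j' := by split_ifs at he <;> omega
  obtain ⟨h1, hi⟩ := eq_of_mul_add_eq i.2 i'.2 hrank
  obtain ⟨hc, hj⟩ := eq_of_mul_add_eq (by omega) (by omega) h1
  simp only [Prod.mk.injEq, Fin.ext_iff]
  omega

lemma entry_mem_Icc {c i j : ℕ} (hc : c < r) (hi : i < 2 * h) (hj : j < 2 * h) :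
    entry r h c i j ∈ Set.Icc 1 (r * (2 * h * (2 * h))) := by
  have hk := pairRank_lt hc hi hj
  have hN : r * (2 * h * (2 * h)) = 2 * (2 * r * h * h) := by ring
  unfold entry
  rw [Set.mem_Icc, hN]
  split_ifs <;> omega

lemma sum_fin_two_mul {a : ℕ → ℕ} {s : ℕ}
    (ha : ∀ t < h, a (2 * t) + a (2 * t + 1) = s) : ∑ i : Fin (2 * h), a i = h * s := by
  rw [Fin.sum_univ_eq_sum_range a (2 * h)]
  induction h with
  | zero => simp
  | succ h ih =>
    rw [show 2 * (h + 1) = 2 * h + 1 + 1 by ring, Finset.sum_range_succ, Finset.sum_range_succ,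
      ih fun t ht => ha t (by omega), add_assoc, ha h (by omega)]
    ring

/-- Columns `2t` and `2t + 1` share a rank and have opposite parities, so their two entries form a
complementary pair. -/
lemma sum_row_entry {c i : ℕ} (hc : c < r) (hi : i < 2 * h) :
    ∑ j : Fin (2 * h), entry r h c i j = h * (4 * r * h * h + 1) := by
  refine sum_fin_two_mul fun t ht => ?_
  have hk := pairRank_lt (j := 2 * t) hc hi (by omega)
  have hN : 4 * r * h * h = 2 * (2 * r * h * h) := by ring
  have he : pairRank h c i (2 * t + 1) = pairRank h c i (2 * t) := by
    unfold pairRank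
    rw [show (2 * t + 1) / 2 = 2 * t / 2 by omega]
  unfold entry
  rw [he, hN]
  split_ifs <;> omega

/-- Rows `2t` and `2t + 1` have ranks `k` and `k + 1`. For even `j` the larger rank is subtracted,
which loses one from the complementary sum; for odd `j` it is added, which gains one. -/
lemma sum_col_entry {c j : ℕ} (hc : c < r) (hj : j < 2 * h) :
    ∑ i : Fin (2 * h), entry r h c i j = h * (4 * r * h * h + if j % 2 = 0 then 0 else 2) := by
  refine sum_fin_two_mul (a := fun i => entry r h c i j) fun t ht => ?_
  have hk := pairRank_lt (i := 2 * t + 1) hc (by omega) hj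
  have hN : 4 * r * h * h = 2 * (2 * r * h * h) := by ring
  have he : pairRank h c (2 * t + 1) j = pairRank h c (2 * t) j + 1 := rfl
  simp only [entry]
  rw [he] at hk ⊢
  rw [hN]
  split_ifs <;> omega

lemma exists_labeling (hh : 0 < h) :
    ∃ f, IsLocalAntimagicLabeling
        (copies r (completeBipartiteGraph (Fin (2 * h)) (Fin (2 * h)))) f ∧
      numColors (copies r (completeBipartiteGraph (Fin (2 * h)) (Fin (2 * h)))) f ≤ 3 := by
  set G := copies r (completeBipartiteGraph (Fin (2 * h)) (Fin (2 * h)))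
  let f := arrayLabeling fun x : Fin r × Fin (2 * h) × Fin (2 * h) => entry r h x.1 x.2.1 x.2.2
  have hrow : ∀ c i, weight G f (c, Sum.inl i) = h * (4 * r * h * h + 1) := fun c i =>
    (weight_inl f c i).trans (sum_row_entry c.2 i.2)
  have hcol : ∀ c (j : Fin (2 * h)), weight G f (c, Sum.inr j) =
      h * (4 * r * h * h + if (j : ℕ) % 2 = 0 then 0 else 2) := fun c j =>
    (weight_inr f c j).trans (sum_col_entry c.2 j.2)
  have hne : ∀ c i d j, weight G f (c, Sum.inl i) ≠ weight G f (d, Sum.inr j) := by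
    intro c i d j he
    rw [hrow, hcol] at he
    have := Nat.eq_of_mul_eq_mul_left hh he
    -- After cancelling `h`, the row value lies strictly between the two column values.
    split_ifs at this <;> omega
  refine ⟨f, ⟨bijOn_arrayLabeling entry_injective fun x => entry_mem_Icc x.1.2 x.2.1.2 x.2.2.2,
    ?_⟩, ?_⟩
  · rintro ⟨c, i | i⟩ ⟨d, j | j⟩ ⟨-, hadj⟩
    · simp at hadj
    · exact hne c i d j
    · exact (hne d j c i).symm
    · simp at hadj
  · refine (Finset.card_le_card (t := {h * (4 * r * h * h + 1), h * (4 * r * h * h + 0),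
      h * (4 * r * h * h + 2)}) ?_).trans Finset.card_le_three
    intro w hw
    obtain ⟨⟨c, i | j⟩, -, rfl⟩ := Finset.mem_image.1 hw
    · rw [hrow]
      simp
    · rw [hcol]
      split_ifs <;> simp

end Construction

end LocalAntimagic

theorem mainTheorem5 (m r : ℕ) (hm : 4 ≤ m) (hm_even : Even m) (hr : 1 ≤ r) :
    LocalAntimagic.chiLa (LocalAntimagic.copies r
      (completeBipartiteGraph (Fin m) (Fin m))) = 3 := by
  obtain ⟨h, rfl⟩ := hm_even.two_dvd
  refine le_antisymm ?_ (le_sInf ?_)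
  · obtain ⟨f, hf, hcard⟩ := LocalAntimagic.exists_labeling (r := r) (h := h) (by omega)
    refine le_trans (sInf_le ⟨f, hf, rfl⟩) ?_
    exact_mod_cast hcard
  · rintro _ ⟨f, hf, rfl⟩
    exact_mod_cast LocalAntimagic.three_le_numColors (by omega) hr hf
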